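/- Let $N=\{1,\dots,n\}$, $n\ge 2$, be a set of agents, $\Omega$ a finite set of states, and let $A_1,\dots,A_n\subseteq\Omega$ be nonempty, pairwise disjoint events with $\bigcup_{i\in N}A_i=\Omega$ ($A_i$ is the payoff-relevant event of agent $i$). An information structure with prior $p_0\in\Delta(\Omega)$ consists of measurable signal spaces $S_1,\dots,S_n$ and a probability measure $P$ on $\Omega\times S_1\times\dots\times S_n$ whose marginal on $\Omega$ is $p_0$; its joint distribution of posteriors is the law under $P$ of the random vector $x=(x_1,\dots,x_n)\in[0,1]^n$, where $x_i=P(A_i\mid s_i)$ is the conditional probability of $A_i$ given agent $i$'s signal $s_i$. Let $\nu$ be a Borel probability measure on $[0,1]^n$ with marginals $\nu_1,\dots,\nu_n$. Then $\nu$ is the joint distribution of posteriors of some information structure with some prior $p_0\in\Delta(\Omega)$ if and only if $$\sum_{i\in N}\int_{C_i}x_i\,d\nu_i(x_i)\;\le\;\nu\Big(\bigcup_{i\in N}\{x\in[0,1]^n : x_i\in C_i\}\Big)\qquad\text{for all measurable } C_1,\dots,C_n\subseteq[0,1],$$ and $$\sum_{i\in N}\int_{[0,1]}x_i\,d\nu_i(x_i)=1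 .$$ -/

import Mathlib

open MeasureTheory ProbabilityTheory

universe u v

/-- An information structure for `n` agents on the state space `Ω`: a measurable signal space `S i`
for each agent, and a joint probability distribution `P` of the state and the signal profile. -/
structure InformationStructure (n : ℕ) (Ω : Type v) [MeasurableSpace Ω] where
  /-- the signal space of each agent -/
  S : Fin n → Type u
  /-- the sigma-algebra on each signal space -/
  mS : ∀ i, MeasurableSpace (S i)
  /-- the joint law of the state and the signals -/
  P : ProbabilityMeasure (Ω × (∀ i, S i))

namespace InformationStructure

attribute [instance] InformationStructure.mS

variable {n : ℕ} {Ω : Type v} [MeasurableSpace Ω]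

/-- The prior of an information structure: the marginal of `P` on the state space. -/
noncomputable def prior (I : InformationStructure.{u, v} n Ω) : ProbabilityMeasure Ω :=
  I.P.map (f := Prod.fst) measurable_fst.aemeasurable

section

variable [StandardBorelSpace Ω] [Nonempty Ω]

/-- The posterior belief `q_i(s) ∈ Δ(Ω)` of agent `i` about the state after observing the signal
`s`: the regular conditional distribution under `P` of the state given the `i`-th signal. -/
noncomputable def belief (I : InformationStructure.{u, v} n Ω) (i : Fin n) :
    Kernel (I.S i) Ω :=
  condDistrib (fun z : Ω × (∀ j, I.S j) => z.1) (fun z => z.2 i)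
    (I.P : Measure (Ω × (∀ j, I.S j)))

instance (I : InformationStructure.{u, v} n Ω) (i : Fin n) : IsMarkovKernel (I.belief i) := by
  unfold belief; infer_instance

/-- The posterior probability `q_i^A(s) = P(A | s) ∈ [0,1]` that agent `i` attributes to the event
`A` after observing the signal `s`. -/
noncomputable def posterior (I : InformationStructure.{u, v} n Ω) (i : Fin n) (A : Set Ω)
    (s : I.S i) : unitInterval :=
  ⟨(I.belief i s).real A, measureReal_nonneg, measureReal_le_one⟩

end

variable [Finite Ω] [DiscreteMeasurableSpace Ω] [Nonempty Ω]

theorem measurable_posterior (I : InformationStructure.{u, v} n Ω) (i : Fin n) (A : Set Ω) :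
    Measurable (I.posterior i A) :=
  ((I.belief i).measurable_coe (MeasurableSet.of_discrete (s := A))).ennreal_toReal.subtype_mk

/-- The profile `x = (x_1, …, x_n)` of posteriors `x_i = q_i^{A_i}(s_i)`, as a random vector. -/
noncomputable def posteriorProfile (I : InformationStructure.{u, v} n Ω) (A : Fin n → Set Ω)
    (z : Ω × (∀ i, I.S i)) : Fin n → unitInterval :=
  fun i => I.posterior i (A i) (z.2 i)

theorem measurable_posteriorProfile (I : InformationStructure.{u, v} n Ω) (A : Fin n → Set Ω) :
    Measurable (I.posteriorProfile A) :=
  measurable_pi_lambda _ fun i =>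
    (I.measurable_posterior i (A i)).comp ((measurable_pi_apply i).comp measurable_snd)

/-- The joint distribution of posteriors induced by `I`, i.e. `B ↦ P(x ∈ B)`. -/
noncomputable def posteriorLaw (I : InformationStructure.{u, v} n Ω) (A : Fin n → Set Ω) :
    ProbabilityMeasure (Fin n → unitInterval) :=
  I.P.map (I.measurable_posteriorProfile A).aemeasurable

end InformationStructure

/-- `ν` is feasible with prior `p₀` for the payoff-relevant events `A`: it is the joint distribution
of posteriors induced by some information structure whose prior is `p₀`. -/
def IsFeasibleWithPrior {n : ℕ} {Ω : Type v} [MeasurableSpace Ω] [Finite Ω]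
    [DiscreteMeasurableSpace Ω] [Nonempty Ω] (A : Fin n → Set Ω) (p₀ : ProbabilityMeasure Ω)
    (ν : ProbabilityMeasure (Fin n → unitInterval)) : Prop :=
  ∃ I : InformationStructure.{u, v} n Ω, I.prior = p₀ ∧ ν = I.posteriorLaw A

/-- The marginal `ν_i` on `[0,1]` of a distribution `ν` on `[0,1]^n`. -/
noncomputable def posteriorMarginal {n : ℕ} (ν : ProbabilityMeasure (Fin n → unitInterval))
    (i : Fin n) : Measure unitInterval :=
  (ν : Measure (Fin n → unitInterval)).map (fun x => x i)

/-!
The feasibility of `ν` is a decomposition problem: `ν` should split as `∑ i, μ i`, where `μ i` is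
the joint law of the posteriors restricted to the states in `A i`. That `x_i` is the posterior
probability of `A i` says that `μ i` agrees with `x_i dν(x)` on the events that depend only on the
`i`-th coordinate.

Given an information structure, the events "the state is in `A i` and `x_i ∈ C i`" are disjoint,
lie in `⋃ i, {x_i ∈ C i}`, and have probability `∫_{C i} x_i dν_i`; this gives the inequalities, and
the equality holds because the `A i` partition the state space
(`InformationStructure.sum_weightedLaw_le`, `InformationStructure.sum_weightedLaw_univ`).

Conversely, the inequalities are those of Hall's theorem, and `exists_measure_decomposition` is the
corresponding theorem of Strassen type. It needs neither topology nor compactness. Integrated over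
superlevel sets, the inequalities say that `g ↦ ∑ i, ∫ g_i(x_i) x_i dν` is dominated by the
sublinear functional `g ↦ ∫ max_i g_i dν` (`sum_integral_le_integral_max`). The Hahn–Banach theorem
extends the former to all families of simple functions on `[0,1]^n`, and the domination forces the
values of the extension on indicators to be nonnegative, to be at most `ν`, and to add up to `ν`.
A finitely additive set function below a finite measure is countably additive
(`exists_measure_of_additive_of_le`), so these values are the measures `μ i`. Finally, the law
`∑ i, δ_{ω i} ⊗ μ i` with `ω i ∈ A i`, in which each agent's signal is the `i`-th coordinate, is an
information structure with joint law of posteriors `ν`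
(`exists_posteriorLaw_eq_of_decomposition`).
-/

/-! ### From additive set functions to measures -/

/-- A finitely additive set function splits off the first `N` terms of a countable disjoint
union. -/
theorem apply_iUnion_eq_sum_range_add {X : Type*} [MeasurableSpace X] (c : Set X → ℝ)
    (hc_add : ∀ s t, MeasurableSet s → MeasurableSet t → Disjoint s t → c (s ∪ t) = c s + c t)
    (f : ℕ → Set X) (hf : ∀ k, MeasurableSet (f k)) (hd : Pairwise (Function.onFun Disjoint f))
    (N : ℕ) : c (⋃ k, f k) = ∑ k ∈ Finset.range N, c (f k) + c (⋃ k, f (k + N)) := by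
  induction N with
  | zero => simp
  | succ N ih =>
    have hsplit : (⋃ k, f (k + N)) = f N ∪ ⋃ k, f (k + (N + 1)) := by
      have h := Set.union_iUnion_nat_succ fun k => f (k + N)
      simp only [zero_add, add_assoc, add_comm 1 N] at h
      exact h.symm
    rw [ih, hsplit, hc_add _ _ (hf N) (.iUnion fun k => hf _) ?_, Finset.sum_range_succ,
      add_assoc]
    exact Set.disjoint_iUnion_right.2 fun k => hd (by omega)

/-- A finitely additive set function dominated by a finite measure is countably additive, so it is
a measure. -/
theorem exists_measure_of_additive_of_le {X : Type*} [MeasurableSpace X] (ν : Measure X)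
    [IsFiniteMeasure ν] (c : Set X → ℝ) (hc_nonneg : ∀ s, MeasurableSet s → 0 ≤ c s)
    (hc_le : ∀ s, MeasurableSet s → c s ≤ ν.real s)
    (hc_add : ∀ s t, MeasurableSet s → MeasurableSet t → Disjoint s t → c (s ∪ t) = c s + c t) :
    ∃ μ : Measure X, ∀ s, MeasurableSet s → μ s = ENNReal.ofReal (c s) := by
  have hc_empty : c ∅ = 0 := by
    have := hc_add ∅ ∅ .empty .empty (Set.disjoint_empty _)
    simpa using this
  refine ⟨Measure.ofMeasurable (fun s _ => ENNReal.ofReal (c s)) (by simp [hc_empty]) ?_,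
    fun s hs => Measure.ofMeasurable_apply s hs⟩
  intro f hf hd
  -- The tails of the union have `ν`-measure, hence `c`-value, tending to zero.
  have htail : Filter.Tendsto (fun N => ν.real (⋃ k, f (k + N))) Filter.atTop (nhds 0) := by
    have hsum : HasSum (fun k => ν.real (f k)) (ν.real (⋃ k, f k)) := by
      have h := ENNReal.hasSum_toReal (f := fun k => ν (f k)) (by
        rw [← measure_iUnion hd hf]; exact measure_ne_top _ _)
      rwa [← ENNReal.tsum_toReal_eq fun k => measure_ne_top _ _, ← measure_iUnion hd hf] at h
    have := (tendsto_const_nhds (x := ν.real (⋃ k, f k))).sub hsum.tendsto_sum_nat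
    rw [sub_self] at this
    refine this.congr fun N => ?_
    rw [apply_iUnion_eq_sum_range_add ν.real (fun s t _ ht hst => measureReal_union hst ht)
      f hf hd N]
    ring
  have hlim : HasSum (fun k => c (f k)) (c (⋃ k, f k)) := by
    rw [hasSum_iff_tendsto_nat_of_nonneg fun k => hc_nonneg _ (hf k)]
    have h0 : Filter.Tendsto (fun N => c (⋃ k, f (k + N))) Filter.atTop (nhds 0) :=
      squeeze_zero (fun N => hc_nonneg _ (.iUnion fun k => hf _))
        (fun N => hc_le _ (.iUnion fun k => hf _)) htail
    have := (tendsto_const_nhds (x := c (⋃ k, f k))).sub h0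
    rw [sub_zero] at this
    refine this.congr fun N => ?_
    rw [apply_iUnion_eq_sum_range_add c hc_add f hf hd N]
    ring
  rw [← hlim.tsum_eq, ENNReal.ofReal_tsum_of_nonneg (fun k => hc_nonneg _ (hf k)) hlim.summable]

/-! ### A decomposition theorem of Strassen type -/

section Decomposition

variable {ι X : Type*} [Fintype ι] [Nonempty ι] [MeasurableSpace X]

/-- The pointwise maximum of a finite family of simple functions. -/
noncomputable def maxSimpleFunc (g : ι → SimpleFunc X ℝ) : SimpleFunc X ℝ :=
  Finset.univ.sup' Finset.univ_nonempty g

theorem maxSimpleFunc_apply (g : ι → SimpleFunc X ℝ) (x : X) :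
    maxSimpleFunc g x = Finset.univ.sup' Finset.univ_nonempty fun i => g i x :=
  Finset.apply_sup'_eq_sup'_comp Finset.univ_nonempty (fun f : SimpleFunc X ℝ => f x)
    fun _ _ => rfl

theorem maxSimpleFunc_le_iff (g : ι → SimpleFunc X ℝ) (x : X) (a : ℝ) :
    maxSimpleFunc g x ≤ a ↔ ∀ i, g i x ≤ a := by
  simp [maxSimpleFunc_apply]

theorem le_maxSimpleFunc (g : ι → SimpleFunc X ℝ) (i : ι) (x : X) :
    g i x ≤ maxSimpleFunc g x :=
  (maxSimpleFunc_le_iff g x _).1 le_rfl i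

theorem lt_maxSimpleFunc_iff (g : ι → SimpleFunc X ℝ) (x : X) (a : ℝ) :
    a < maxSimpleFunc g x ↔ ∃ i, a < g i x := by
  simp [maxSimpleFunc_apply]

/-- Hall-type inequalities for sets integrate, over the superlevel sets, to an inequality for
nonnegative functions. -/
theorem sum_integral_le_integral_max_of_nonneg (ν : Measure X) [IsFiniteMeasure ν]
    (lam : ι → Measure X) [∀ i, IsFiniteMeasure (lam i)] (m : ι → MeasurableSpace X)
    (hle : ∀ C : ι → Set X, (∀ i, MeasurableSet[m i] (C i)) →
      ∑ i, lam i (C i) ≤ ν (⋃ i, C i))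
    (g : ι → SimpleFunc X ℝ) (hg : ∀ i, Measurable[m i] (g i)) (hg0 : ∀ i x, 0 ≤ g i x) :
    ∑ i, ∫ x, g i x ∂(lam i) ≤ ∫ x, maxSimpleFunc g x ∂ν := by
  have hmax0 : ∀ x, 0 ≤ maxSimpleFunc g x := fun x =>
    (hg0 (Classical.arbitrary ι) x).trans (le_maxSimpleFunc g _ x)
  have hlayer : ∀ (f : SimpleFunc X ℝ) (ρ : Measure X), [IsFiniteMeasure ρ] → (∀ x, 0 ≤ f x) →
      ENNReal.ofReal (∫ x, f x ∂ρ) = ∫⁻ t in Set.Ioi (0 : ℝ), ρ {x | t < f x} := by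
    intro f ρ _ hf
    rw [ofReal_integral_eq_lintegral_ofReal (SimpleFunc.integrable_of_isFiniteMeasure f)
      (.of_forall hf), lintegral_eq_lintegral_meas_lt ρ (.of_forall hf) f.measurable.aemeasurable]
  rw [← ENNReal.ofReal_le_ofReal_iff (integral_nonneg hmax0),
    ENNReal.ofReal_sum_of_nonneg fun i _ => integral_nonneg (hg0 i), hlayer _ _ hmax0]
  simp_rw [fun i => hlayer (g i) (lam i) (hg0 i)]
  rw [← lintegral_finsetSum']
  · -- The superlevel set of the maximum is the union of the superlevel sets.
    refine lintegral_mono fun t => ?_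
    refine (hle (fun i => {x | t < g i x}) fun i => hg i measurableSet_Ioi).trans
      (measure_mono ?_)
    intro x hx
    simpa [lt_maxSimpleFunc_iff] using hx
  · intro i _
    have : Antitone fun t : ℝ => lam i {x | t < g i x} := fun s t hst =>
      measure_mono fun x hx => lt_of_le_of_lt hst hx
    exact this.measurable.aemeasurable

theorem integrable_simpleFunc (f : SimpleFunc X ℝ) (ρ : Measure X) [IsFiniteMeasure ρ] :
    Integrable f ρ :=
  SimpleFunc.integrable_of_isFiniteMeasure f

/-- The nonnegative case extends to all functions because both sides move by the same amount when
a constant is added to every function. -/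
theorem sum_integral_le_integral_max (ν : Measure X) [IsFiniteMeasure ν]
    (lam : ι → Measure X) [∀ i, IsFiniteMeasure (lam i)] (m : ι → MeasurableSpace X)
    (hle : ∀ C : ι → Set X, (∀ i, MeasurableSet[m i] (C i)) →
      ∑ i, lam i (C i) ≤ ν (⋃ i, C i))
    (htot : ∑ i, lam i Set.univ = ν Set.univ)
    (g : ι → SimpleFunc X ℝ) (hg : ∀ i, Measurable[m i] (g i)) :
    ∑ i, ∫ x, g i x ∂(lam i) ≤ ∫ x, maxSimpleFunc g x ∂ν := by
  -- Simple functions are bounded, so a constant makes all of them nonnegative.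
  obtain ⟨a, ha⟩ : ∃ a : ℝ, ∀ i x, 0 ≤ g i x + a := by
    have hb : ∀ i, ∃ b : ℝ, ∀ x, b ≤ g i x := fun i => by
      obtain ⟨b, hb⟩ := (g i).finite_range.bddBelow
      exact ⟨b, fun x => hb ⟨x, rfl⟩⟩
    choose b hb using hb
    obtain ⟨b', hb'⟩ := (Set.finite_range b).bddBelow
    exact ⟨-b', fun i x => by linarith [hb i x, hb' ⟨i, rfl⟩]⟩
  have hshift := sum_integral_le_integral_max_of_nonneg ν lam m hle
    (fun i => g i + SimpleFunc.const X a) (fun i => (hg i).add_const a) (by simpa using ha)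
  have hmax : ∀ x, maxSimpleFunc (fun i => g i + SimpleFunc.const X a) x
      = maxSimpleFunc g x + a := by
    intro x
    refine le_antisymm ((maxSimpleFunc_le_iff _ _ _).2 fun i => ?_) ?_
    · simpa using le_maxSimpleFunc g i x
    · rw [← le_sub_iff_add_le, maxSimpleFunc_le_iff]
      intro i
      have := le_maxSimpleFunc (fun i => g i + SimpleFunc.const X a) i x
      simp only [SimpleFunc.coe_add, Pi.add_apply, SimpleFunc.const_apply] at this
      linarith
  have htot' : ∑ i, (lam i).real Set.univ = ν.real Set.univ := by
    simp only [Measure.real]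
    rw [← htot, ENNReal.toReal_sum fun i _ => measure_ne_top _ _]
  simp only [hmax, SimpleFunc.coe_add, Pi.add_apply, SimpleFunc.const_apply] at hshift
  rw [integral_add (integrable_simpleFunc _ _) (integrable_const a)] at hshift
  simp_rw [fun i => integral_add (integrable_simpleFunc (g i) (lam i)) (integrable_const a)]
    at hshift
  simp only [integral_const, smul_eq_mul, Finset.sum_add_distrib, ← Finset.sum_mul, htot']
    at hshift
  linarith

/-- By the Hahn–Banach theorem, the functional `g ↦ ∑ i, ∫ g i ∂(lam i)` on the families of
`m i`-measurable simple functions extends to all families of simple functions, still dominated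
by the sublinear functional `g ↦ ∫ max g ∂ν`. -/
theorem exists_functional_le_integral_max (ν : Measure X) [IsFiniteMeasure ν]
    (lam : ι → Measure X) [∀ i, IsFiniteMeasure (lam i)] (m : ι → MeasurableSpace X)
    (hle : ∀ C : ι → Set X, (∀ i, MeasurableSet[m i] (C i)) →
      ∑ i, lam i (C i) ≤ ν (⋃ i, C i))
    (htot : ∑ i, lam i Set.univ = ν Set.univ) :
    ∃ Φ : (ι → SimpleFunc X ℝ) →ₗ[ℝ] ℝ,
      (∀ g : ι → SimpleFunc X ℝ, (∀ i, Measurable[m i] (g i)) →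
        Φ g = ∑ i, ∫ x, g i x ∂(lam i)) ∧
      ∀ g, Φ g ≤ ∫ x, maxSimpleFunc g x ∂ν := by
  let L : (ι → SimpleFunc X ℝ) →ₗ[ℝ] ℝ :=
    { toFun := fun g => ∑ i, ∫ x, g i x ∂(lam i)
      map_add' := fun g h => by
        rw [← Finset.sum_add_distrib]
        refine Finset.sum_congr rfl fun i _ => ?_
        exact integral_add (integrable_simpleFunc (g i) (lam i)) (integrable_simpleFunc (h i) _)
      map_smul' := fun a g => by
        simp [integral_const_mul, Finset.mul_sum] }
  let V : Submodule ℝ (ι → SimpleFunc X ℝ) :=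
    { carrier := {g | ∀ i, Measurable[m i] (g i)}
      add_mem' := fun hg hh i => (hg i).add (hh i)
      zero_mem' := fun i => measurable_const (a := (0 : ℝ))
      smul_mem' := fun a g hg i => (hg i).const_smul a }
  have hhom : ∀ a : ℝ, 0 < a → ∀ g : ι → SimpleFunc X ℝ,
      ∫ x, maxSimpleFunc (a • g) x ∂ν = a * ∫ x, maxSimpleFunc g x ∂ν := by
    intro a ha g
    rw [← integral_const_mul]
    refine integral_congr_ae (.of_forall fun x => ?_)
    refine le_antisymm ((maxSimpleFunc_le_iff _ _ _).2 fun i => ?_) ?_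
    · exact mul_le_mul_of_nonneg_left (le_maxSimpleFunc g i x) ha.le
    · beta_reduce
      rw [mul_comm, ← le_div_iff₀ ha, maxSimpleFunc_le_iff]
      intro i
      rw [le_div_iff₀ ha, mul_comm]
      exact le_maxSimpleFunc (a • g) i x
  have hadd : ∀ g h : ι → SimpleFunc X ℝ, ∫ x, maxSimpleFunc (g + h) x ∂ν ≤
      ∫ x, maxSimpleFunc g x ∂ν + ∫ x, maxSimpleFunc h x ∂ν := by
    intro g h
    rw [← integral_add (integrable_simpleFunc _ _) (integrable_simpleFunc _ _)]
    refine integral_mono (integrable_simpleFunc _ _)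
      ((integrable_simpleFunc _ _).add (integrable_simpleFunc _ _)) fun x => ?_
    exact (maxSimpleFunc_le_iff _ _ _).2 fun i =>
      add_le_add (le_maxSimpleFunc g i x) (le_maxSimpleFunc h i x)
  obtain ⟨Φ, hΦ, hΦN⟩ := exists_extension_of_le_sublinear (L.toPMap V)
    (fun g => ∫ x, maxSimpleFunc g x ∂ν) hhom hadd
    fun g => sum_integral_le_integral_max ν lam m hle htot g g.2
  exact ⟨Φ, fun g hg => hΦ ⟨g, hg⟩, hΦN⟩

theorem integral_restrict_one (ρ : Measure X) {B : Set X} (hB : MeasurableSet B) :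
    ∫ x, (SimpleFunc.restrict (1 : SimpleFunc X ℝ) B) x ∂ρ = ρ.real B := by
  simp only [SimpleFunc.coe_restrict _ hB, SimpleFunc.coe_one]
  exact integral_indicator_one hB

/-- If the finite measures `lam i` satisfy the Hall-type inequalities
`∑ i, lam i (C i) ≤ ν (⋃ i, C i)` for `C i` in the sub-σ-algebras `m i`, with equality of total
masses, then `ν` splits into a sum of measures that agree with `lam i` on `m i`. -/
theorem exists_measure_decomposition (ν : Measure X) [IsFiniteMeasure ν]
    (lam : ι → Measure X) [∀ i, IsFiniteMeasure (lam i)] (m : ι → MeasurableSpace X)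
    (hm : ∀ i, m i ≤ ‹MeasurableSpace X›)
    (hle : ∀ C : ι → Set X, (∀ i, MeasurableSet[m i] (C i)) →
      ∑ i, lam i (C i) ≤ ν (⋃ i, C i))
    (htot : ∑ i, lam i Set.univ = ν Set.univ) :
    ∃ μ : ι → Measure X, ∑ i, μ i = ν ∧
      ∀ i C, MeasurableSet[m i] C → μ i C = lam i C := by
  classical
  obtain ⟨Φ, hΦ, hΦN⟩ := exists_functional_le_integral_max ν lam m hle htot
  let ind : Set X → SimpleFunc X ℝ := fun B => SimpleFunc.restrict 1 B
  have hind : ∀ {B}, MeasurableSet B → ∀ x, ind B x = B.indicator (fun _ => 1) x :=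
    fun hB x => by simp only [ind, SimpleFunc.coe_restrict _ hB]; rfl
  have hind0 : ∀ {B}, MeasurableSet B → ∀ x, 0 ≤ ind B x := fun hB x => by
    rw [hind hB]; exact Set.indicator_nonneg (fun _ _ => zero_le_one) x
  let c : ι → Set X → ℝ := fun i B => Φ (Pi.single i (ind B))
  have hbound : ∀ (g : ι → SimpleFunc X ℝ) (f : SimpleFunc X ℝ), (∀ i x, g i x ≤ f x) →
      Φ g ≤ ∫ x, f x ∂ν := fun g f h => (hΦN g).trans <|
    integral_mono (integrable_simpleFunc _ _) (integrable_simpleFunc _ _) fun x =>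
      (maxSimpleFunc_le_iff _ _ _).2 fun i => h i x
  have hc_nonneg : ∀ i B, MeasurableSet B → 0 ≤ c i B := by
    intro i B hB
    -- Every entry of the negated family is nonpositive, so its maximum is at most `0`.
    have := hbound (-Pi.single i (ind B)) 0 fun j x => by
      rcases eq_or_ne j i with rfl | hj
      · simpa using hind0 hB x
      · simp [hj]
    simpa [c] using this
  have hc_le : ∀ i B, MeasurableSet B → c i B ≤ ν.real B := by
    intro i B hB
    rw [← integral_restrict_one ν hB]
    refine hbound _ _ fun j x => ?_
    rcases eq_or_ne j i with rfl | hj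
    · simp [ind]
    · simpa [hj] using hind0 hB x
  have hc_add : ∀ i s t, MeasurableSet s → MeasurableSet t → Disjoint s t →
      c i (s ∪ t) = c i s + c i t := by
    intro i s t hs ht hst
    have : ind (s ∪ t) = ind s + ind t := by
      ext x
      simp only [SimpleFunc.coe_add, Pi.add_apply, hind hs, hind ht, hind (hs.union ht)]
      rw [Set.indicator_union_of_disjoint hst]
    simp only [c, this, Pi.single_add, map_add]
  have hc_sum : ∀ B, MeasurableSet B → ∑ i, c i B = ν.real B := by
    intro B hB
    have hconst : ∑ i, c i B = Φ (fun _ => ind B) := by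
      simp only [c, ← map_sum]
      rw [Finset.univ_sum_single]
    rw [hconst, ← integral_restrict_one ν hB]
    -- On a constant family the maximum is linear, so the domination holds in both directions.
    refine le_antisymm (hbound _ _ fun _ _ => le_rfl) ?_
    have := hbound (-fun _ => ind B) (-ind B) fun _ _ => le_rfl
    simp only [map_neg, SimpleFunc.coe_neg, Pi.neg_apply, integral_neg] at this
    exact neg_le_neg_iff.1 this
  choose μ hμ using fun i =>
    exists_measure_of_additive_of_le ν (c i) (hc_nonneg i) (hc_le i) (hc_add i)
  refine ⟨μ, ?_, fun i C hC => ?_⟩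
  · ext B hB
    rw [Measure.finsetSum_apply, Finset.sum_congr rfl fun i _ => hμ i B hB,
      ← ENNReal.ofReal_sum_of_nonneg fun i _ => hc_nonneg i B hB, hc_sum B hB]
    simp
  · have hC' := hm i C hC
    have hval : c i C = (lam i).real C := by
      simp only [c]
      rw [hΦ, Finset.sum_eq_single i]
      · simpa using integral_restrict_one (lam i) hC'
      · intro j _ hj
        simp [hj]
      · simp
      · intro j
        rcases eq_or_ne j i with rfl | hj
        · simp only [Pi.single_eq_same, ind, SimpleFunc.coe_restrict _ hC']
          exact (measurable_const (a := (1 : ℝ))).indicator hC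
        · simp only [Pi.single_eq_of_ne hj]
          exact measurable_const (a := (0 : ℝ))
    rw [hμ i C hC', hval]
    simp

end Decomposition

/-! ### Posteriors as conditional probabilities -/

/-- The integral of the `i`-th posterior over an event describing the `i`-th signal is the
probability of this event together with `A`. -/
theorem InformationStructure.setLIntegral_belief {n : ℕ} {Ω : Type v} [MeasurableSpace Ω]
    [StandardBorelSpace Ω] [Nonempty Ω] (I : InformationStructure.{u, v} n Ω) (i : Fin n)
    {A : Set Ω} (hA : MeasurableSet A) {B : Set (I.S i)} (hB : MeasurableSet B) :
    ∫⁻ z in {z | z.2 i ∈ B}, I.belief i (z.2 i) A ∂(I.P : Measure (Ω × (∀ j, I.S j))) =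
      (I.P : Measure (Ω × (∀ j, I.S j))) {z | z.1 ∈ A ∧ z.2 i ∈ B} := by
  have := setLIntegral_preimage_condDistrib (μ := (I.P : Measure (Ω × (∀ j, I.S j))))
    (X := fun z => z.2 i) (Y := fun z => z.1) ((measurable_pi_apply i).comp measurable_snd)
    measurable_fst.aemeasurable hA hB
  rw [show {z : Ω × (∀ j, I.S j) | z.1 ∈ A ∧ z.2 i ∈ B}
    = (fun z => z.2 i) ⁻¹' B ∩ (fun z => z.1) ⁻¹' A from Set.ext fun z => and_comm]
  exact this

theorem InformationStructure.ofReal_posterior {n : ℕ} {Ω : Type v} [MeasurableSpace Ω]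
    [StandardBorelSpace Ω] [Nonempty Ω] (I : InformationStructure.{u, v} n Ω) (i : Fin n)
    (A : Set Ω) (s : I.S i) :
    ENNReal.ofReal (I.posterior i A s : ℝ) = I.belief i s A := by
  simp [InformationStructure.posterior]

/-- The measure `x_i dν(x)` on profiles of posteriors. -/
noncomputable def weightedLaw {n : ℕ} (ν : ProbabilityMeasure (Fin n → unitInterval))
    (i : Fin n) : Measure (Fin n → unitInterval) :=
  (ν : Measure (Fin n → unitInterval)).withDensity fun x => ENNReal.ofReal (x i : ℝ)

theorem measurable_ofReal_coord {n : ℕ} (i : Fin n) :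
    Measurable fun x : Fin n → unitInterval => ENNReal.ofReal (x i : ℝ) :=
  (measurable_subtype_coe.comp (measurable_pi_apply i)).ennreal_ofReal

instance isFiniteMeasure_weightedLaw {n : ℕ} (ν : ProbabilityMeasure (Fin n → unitInterval))
    (i : Fin n) : IsFiniteMeasure (weightedLaw ν i) := by
  refine isFiniteMeasure_withDensity (ne_of_lt ?_)
  calc ∫⁻ x, ENNReal.ofReal (x i : ℝ) ∂(ν : Measure (Fin n → unitInterval))
      ≤ ∫⁻ _, 1 ∂(ν : Measure (Fin n → unitInterval)) :=
        lintegral_mono fun x => ENNReal.ofReal_le_one.2 (x i).2.2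
    _ < ⊤ := by simp

theorem setIntegral_posteriorMarginal {n : ℕ} (ν : ProbabilityMeasure (Fin n → unitInterval))
    (i : Fin n) {C : Set unitInterval} (hC : MeasurableSet C) :
    ∫ x in C, (x : ℝ) ∂(posteriorMarginal ν i) = (weightedLaw ν i).real {x | x i ∈ C} := by
  have hC' : MeasurableSet {x : Fin n → unitInterval | x i ∈ C} := measurable_pi_apply i hC
  rw [posteriorMarginal, setIntegral_map hC measurable_subtype_coe.aestronglyMeasurable
    (measurable_pi_apply i).aemeasurable, Measure.real, weightedLaw, withDensity_apply _ hC',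
    integral_eq_lintegral_of_nonneg_ae (.of_forall fun x => (x i).2.1)
      (f := fun x : Fin n → unitInterval => (x i : ℝ))
      (measurable_subtype_coe.comp (measurable_pi_apply i)).aestronglyMeasurable]
  rfl

/-! ### Necessity -/

/-- Under the law of the posteriors of an information structure, the measure `x_i dν(x)` of an
event about the `i`-th posterior is the probability of this event together with `A i`. -/
theorem InformationStructure.weightedLaw_posteriorLaw {n : ℕ} {Ω : Type v} [MeasurableSpace Ω]
    [Finite Ω] [DiscreteMeasurableSpace Ω] [Nonempty Ω] (I : InformationStructure.{u, v} n Ω)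
    (A : Fin n → Set Ω) (i : Fin n) {C : Set unitInterval} (hC : MeasurableSet C) :
    weightedLaw (I.posteriorLaw A) i {x | x i ∈ C} =
      (I.P : Measure (Ω × (∀ j, I.S j))) {z | z.1 ∈ A i ∧ I.posteriorProfile A z i ∈ C} := by
  have hC' : MeasurableSet {x : Fin n → unitInterval | x i ∈ C} := measurable_pi_apply i hC
  rw [weightedLaw, withDensity_apply _ hC', InformationStructure.posteriorLaw,
    ProbabilityMeasure.toMeasure_map,
    setLIntegral_map hC' (measurable_ofReal_coord i) (I.measurable_posteriorProfile A)]
  simp only [InformationStructure.posteriorProfile, InformationStructure.ofReal_posterior]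
  exact I.setLIntegral_belief i (A := A i) .of_discrete
    (B := I.posterior i (A i) ⁻¹' C) (I.measurable_posterior i (A i) hC)

/-- The events "the state is in `A i` and the `i`-th posterior is in `C i`" are disjoint and
contained in the event that some posterior is in its set `C i`. -/
theorem InformationStructure.sum_weightedLaw_le {n : ℕ} {Ω : Type v} [MeasurableSpace Ω]
    [Finite Ω] [DiscreteMeasurableSpace Ω] [Nonempty Ω] (I : InformationStructure.{u, v} n Ω)
    (A : Fin n → Set Ω) (hA_disjoint : ∀ i j, i ≠ j → Disjoint (A i) (A j))
    (C : Fin n → Set unitInterval) (hC : ∀ i, MeasurableSet (C i)) :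
    ∑ i, weightedLaw (I.posteriorLaw A) i {x | x i ∈ C i} ≤
      (I.posteriorLaw A : Measure (Fin n → unitInterval)) (⋃ i, {x | x i ∈ C i}) := by
  have hC' : ∀ i, MeasurableSet {x : Fin n → unitInterval | x i ∈ C i} := fun i =>
    measurable_pi_apply i (hC i)
  simp_rw [fun i => I.weightedLaw_posteriorLaw A i (hC i)]
  rw [← tsum_fintype (L := .unconditional _), ← measure_iUnion]
  · rw [InformationStructure.posteriorLaw, ProbabilityMeasure.toMeasure_map,
      Measure.map_apply (I.measurable_posteriorProfile A) (.iUnion hC')]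
    refine measure_mono (Set.iUnion_subset fun i z hz => ?_)
    exact Set.mem_iUnion.2 ⟨i, hz.2⟩
  · intro i j hij
    exact Set.disjoint_left.2 fun z hz hz' =>
      Set.disjoint_left.1 (hA_disjoint i j hij) hz.1 hz'.1
  · intro i
    exact (measurable_fst (MeasurableSet.of_discrete (s := A i))).inter
      (I.measurable_posteriorProfile A (hC' i))

theorem InformationStructure.sum_weightedLaw_univ {n : ℕ} {Ω : Type v} [MeasurableSpace Ω]
    [Finite Ω] [DiscreteMeasurableSpace Ω] [Nonempty Ω] (I : InformationStructure.{u, v} n Ω)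
    (A : Fin n → Set Ω) (hA_disjoint : ∀ i j, i ≠ j → Disjoint (A i) (A j))
    (hA_cover : ⋃ i, A i = Set.univ) :
    ∑ i, weightedLaw (I.posteriorLaw A) i Set.univ = 1 := by
  have h := fun i => I.weightedLaw_posteriorLaw A i MeasurableSet.univ
  simp only [Set.mem_univ, Set.ofPred_true, and_true] at h
  simp_rw [h]
  rw [← tsum_fintype (L := .unconditional _), ← measure_iUnion]
  · rw [← measure_univ (μ := (I.P : Measure (Ω × (∀ j, I.S j))))]
    congr 1
    ext z
    simpa using Set.ext_iff.1 hA_cover z.1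
  · intro i j hij
    exact Set.disjoint_left.2 fun z hz hz' =>
      Set.disjoint_left.1 (hA_disjoint i j hij) hz hz'
  · exact fun i => measurable_fst (MeasurableSet.of_discrete (s := A i))

/-! ### Sufficiency -/

/-- If `ν = ∑ i, μ i` and `μ i` agrees with `x_i dν(x)` on the events about the `i`-th coordinate,
then `ν` is the law of the posteriors when the state-signal pair has law
`∑ i, δ_{ω i} ⊗ μ i` for `ω i ∈ A i`: each agent's signal is then his own posterior. -/
theorem exists_posteriorLaw_eq_of_decomposition {n : ℕ} {Ω : Type v} [MeasurableSpace Ω]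
    [Finite Ω] [DiscreteMeasurableSpace Ω] [Nonempty Ω] (A : Fin n → Set Ω)
    (hA_nonempty : ∀ i, (A i).Nonempty)
    (hA_disjoint : ∀ i j, i ≠ j → Disjoint (A i) (A j))
    (ν : ProbabilityMeasure (Fin n → unitInterval))
    (μ : Fin n → Measure (Fin n → unitInterval)) (hμ_sum : ∑ i, μ i = ν)
    (hμ : ∀ i (C : Set unitInterval), MeasurableSet C →
      μ i {x | x i ∈ C} = weightedLaw ν i {x | x i ∈ C}) :
    ∃ I : InformationStructure.{u, v} n Ω, ν = I.posteriorLaw A := by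
  choose ω hω using hA_nonempty
  -- The signal space `[0,1]` is lifted to the universe prescribed for signal spaces.
  let lift : (Fin n → unitInterval) → (Fin n → ULift.{u} unitInterval) := fun x j => ⟨x j⟩
  have hlift : Measurable lift :=
    measurable_pi_lambda _ fun j => measurable_up.comp (measurable_pi_apply j)
  have hpair : ∀ i, Measurable fun x => (ω i, lift x) := fun i => measurable_const.prodMk hlift
  let P : Measure (Ω × (Fin n → ULift.{u} unitInterval)) :=
    ∑ i, (μ i).map fun x => (ω i, lift x)
  have hP_apply : ∀ B, MeasurableSet B → P B = ∑ i, μ i {x | (ω i, lift x) ∈ B} := by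
    intro B hB
    simp only [P, Measure.finsetSum_apply]
    exact Finset.sum_congr rfl fun i _ => Measure.map_apply (hpair i) hB
  have hP_signal : ∀ B, MeasurableSet B →
      P (Prod.snd ⁻¹' B) = (ν : Measure (Fin n → unitInterval)) (lift ⁻¹' B) := by
    intro B hB
    rw [hP_apply _ (measurable_snd hB), ← hμ_sum, Measure.finsetSum_apply]
    rfl
  have hP : IsProbabilityMeasure P := ⟨by simpa using hP_signal Set.univ .univ⟩
  let I : InformationStructure.{u, v} n Ω :=
    { S := fun _ => ULift.{u} unitInterval
      mS := fun _ => inferInstance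
      P := ⟨P, hP⟩ }
  have hP_snd : P.map Prod.snd = (ν : Measure (Fin n → unitInterval)).map lift := by
    ext B hB
    rw [Measure.map_apply measurable_snd hB, Measure.map_apply hlift hB, hP_signal B hB]
  -- The joint law of `A i` and the signal of agent `i` is `x_i dν(x)`.
  have hP_event : ∀ i (C : Set unitInterval), MeasurableSet C →
      P {z | z.1 ∈ A i ∧ (z.2 i).down ∈ C} = weightedLaw ν i {x | x i ∈ C} := by
    intro i C hC
    have hmeas : MeasurableSet
        {z : Ω × (Fin n → ULift.{u} unitInterval) | z.1 ∈ A i ∧ (z.2 i).down ∈ C} :=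
      (measurable_fst (MeasurableSet.of_discrete (s := A i))).inter
        ((measurable_down.comp ((measurable_pi_apply i).comp measurable_snd)) hC)
    rw [hP_apply _ hmeas, Finset.sum_eq_single i, ← hμ i C hC]
    · simp [hω i, lift]
    · intro j _ hj
      have : ω j ∉ A i := Set.disjoint_left.1 (hA_disjoint j i hj) (hω j)
      simp [this]
    · simp
  have hposterior : ∀ i, ∀ᵐ x ∂(ν : Measure (Fin n → unitInterval)),
      I.posterior i (A i) ⟨x i⟩ = x i := by
    intro i
    have hproj : Measurable fun x : Fin n → unitInterval => x i := measurable_pi_apply i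
    have hf : Measurable fun t : unitInterval => I.belief i ⟨t⟩ (A i) :=
      ((I.belief i).measurable_coe (MeasurableSet.of_discrete (s := A i))).comp measurable_up
    have hg : Measurable fun t : unitInterval => ENNReal.ofReal (t : ℝ) :=
      measurable_subtype_coe.ennreal_ofReal
    have key : (fun t : unitInterval => I.belief i ⟨t⟩ (A i))
        =ᵐ[(ν : Measure (Fin n → unitInterval)).map fun x => x i]
          fun t => ENNReal.ofReal (t : ℝ) := by
      have : IsProbabilityMeasure ((ν : Measure (Fin n → unitInterval)).map fun x => x i) :=
        Measure.isProbabilityMeasure_map hproj.aemeasurable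
      refine ae_eq_of_forall_setLIntegral_eq_of_sigmaFinite hf hg fun C hC _ => ?_
      rw [setLIntegral_map hC hf hproj, setLIntegral_map hC hg hproj]
      have h := I.setLIntegral_belief i (A := A i) .of_discrete (B := ULift.down ⁻¹' C)
        (measurable_down hC)
      have hB : MeasurableSet {s : Fin n → ULift.{u} unitInterval | (s i).down ∈ C} :=
        (measurable_down.comp (measurable_pi_apply i)) hC
      have hF : Measurable fun s : Fin n → ULift.{u} unitInterval => I.belief i (s i) (A i) :=
        ((I.belief i).measurable_coe (MeasurableSet.of_discrete (s := A i))).comp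
          (measurable_pi_apply i)
      calc ∫⁻ x in (fun x : Fin n → unitInterval => x i) ⁻¹' C, I.belief i ⟨x i⟩ (A i) ∂ν
          = ∫⁻ s in {s : Fin n → ULift.{u} unitInterval | (s i).down ∈ C},
              I.belief i (s i) (A i) ∂((ν : Measure (Fin n → unitInterval)).map lift) := by
            rw [setLIntegral_map hB hF hlift]; rfl
        _ = ∫⁻ z in {z : Ω × (Fin n → ULift.{u} unitInterval) | (z.2 i).down ∈ C},
              I.belief i (z.2 i) (A i) ∂P := by
            rw [← hP_snd, setLIntegral_map hB hF measurable_snd]; rfl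
        _ = P {z | z.1 ∈ A i ∧ (z.2 i).down ∈ C} := h
        _ = ∫⁻ x in (fun x : Fin n → unitInterval => x i) ⁻¹' C,
              ENNReal.ofReal (x i : ℝ) ∂ν := by
            rw [hP_event i C hC]; exact withDensity_apply _ (hproj hC)
    filter_upwards [ae_of_ae_map hproj.aemeasurable key] with x hx
    rw [← I.ofReal_posterior] at hx
    exact Subtype.ext ((ENNReal.ofReal_eq_ofReal_iff (I.posterior i (A i) ⟨x i⟩).2.1
      (x i).2.1).1 hx)
  refine ⟨I, Subtype.ext ?_⟩
  have hprofile : Measurable fun s : Fin n → ULift.{u} unitInterval =>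
      fun i => I.posterior i (A i) (s i) :=
    measurable_pi_lambda _ fun i => (I.measurable_posterior i (A i)).comp (measurable_pi_apply i)
  change (ν : Measure (Fin n → unitInterval)) = P.map (I.posteriorProfile A)
  calc (ν : Measure (Fin n → unitInterval))
      = (ν : Measure (Fin n → unitInterval)).map
          fun x i => I.posterior i (A i) ⟨x i⟩ := by
        conv_lhs => rw [← Measure.map_id (μ := (ν : Measure (Fin n → unitInterval)))]
        refine Measure.map_congr ?_
        filter_upwards [ae_all_iff.2 hposterior] with x hx
        exact funext fun i => (hx i).symm
    _ = ((ν : Measure (Fin n → unitInterval)).map lift).map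
          fun s i => I.posterior i (A i) (s i) := (Measure.map_map hprofile hlift).symm
    _ = P.map (I.posteriorProfile A) := by
        rw [← hP_snd]; exact Measure.map_map hprofile measurable_snd

/-! ### Characterization of feasibility -/

theorem theorem4 {n : ℕ} (hn : 2 ≤ n) {Ω : Type v} [MeasurableSpace Ω] [Finite Ω]
    [DiscreteMeasurableSpace Ω] [Nonempty Ω] (A : Fin n → Set Ω)
    (hA_nonempty : ∀ i, (A i).Nonempty)
    (hA_disjoint : ∀ i j, i ≠ j → Disjoint (A i) (A j))
    (hA_cover : ⋃ i, A i = Set.univ)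
    (ν : ProbabilityMeasure (Fin n → unitInterval)) :
    (∃ p₀ : ProbabilityMeasure Ω, IsFeasibleWithPrior.{u, v} A p₀ ν) ↔
      (∀ C : Fin n → Set unitInterval, (∀ i, MeasurableSet (C i)) →
        ∑ i, ∫ x in C i, (x : ℝ) ∂(posteriorMarginal ν i) ≤
          (ν : Measure (Fin n → unitInterval)).real (⋃ i, {x | x i ∈ C i})) ∧
      ∑ i, ∫ x, (x : ℝ) ∂(posteriorMarginal ν i) = 1 := by
  have : Nonempty (Fin n) := ⟨⟨0, by omega⟩⟩
  -- Both conditions are restated in `[0, ∞]` for the measures `x_i dν(x)`.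
  have hle_iff : ∀ C : Fin n → Set unitInterval, (∀ i, MeasurableSet (C i)) →
      ((∑ i, ∫ x in C i, (x : ℝ) ∂(posteriorMarginal ν i) ≤
          (ν : Measure (Fin n → unitInterval)).real (⋃ i, {x | x i ∈ C i})) ↔
        ∑ i, weightedLaw ν i {x | x i ∈ C i} ≤
          (ν : Measure (Fin n → unitInterval)) (⋃ i, {x | x i ∈ C i})) := by
    intro C hC
    simp_rw [fun i => setIntegral_posteriorMarginal ν i (hC i), Measure.real]
    rw [← ENNReal.toReal_sum fun i _ => measure_ne_top _ _,
      ENNReal.toReal_le_toReal (ENNReal.sum_ne_top.2 fun i _ => measure_ne_top _ _)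
        (measure_ne_top _ _)]
  have htot_iff : ∑ i, ∫ x, (x : ℝ) ∂(posteriorMarginal ν i) = 1 ↔
      ∑ i, weightedLaw ν i Set.univ = 1 := by
    have h := fun i => setIntegral_posteriorMarginal ν i MeasurableSet.univ
    simp only [Measure.restrict_univ, Set.mem_univ, Set.ofPred_true] at h
    simp_rw [h, Measure.real]
    rw [← ENNReal.toReal_sum fun i _ => measure_ne_top _ _, ENNReal.toReal_eq_one_iff]
  rw [htot_iff]
  constructor
  · rintro ⟨p₀, I, -, rfl⟩
    exact ⟨fun C hC => (hle_iff C hC).2 (I.sum_weightedLaw_le A hA_disjoint C hC),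
      I.sum_weightedLaw_univ A hA_disjoint hA_cover⟩
  · rintro ⟨hle, htot⟩
    obtain ⟨μ, hμ_sum, hμ⟩ := exists_measure_decomposition
      (ν : Measure (Fin n → unitInterval)) (weightedLaw ν)
      (fun i => MeasurableSpace.comap (fun x : Fin n → unitInterval => x i) inferInstance)
      (fun i => (measurable_pi_apply i).comap_le)
      (fun C hC => by
        choose D hD hDC using hC
        obtain rfl : (fun i => {x : Fin n → unitInterval | x i ∈ D i}) = C := funext hDC
        exact (hle_iff D hD).1 (hle D hD))
      (by rw [htot, measure_univ])
    obtain ⟨I, hI⟩ := exists_posteriorLaw_eq_of_decomposition.{u, v} A hA_nonempty hA_disjoint ν μ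
      hμ_sum fun i C hC => hμ i _ ⟨C, hC, rfl⟩
    exact ⟨I.prior, I, rfl, hI⟩
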